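/- Let $\mathcal H$ be a separable real Hilbert space and let $\mathrm P,\mathrm Q$ be Borel probability measures on $\mathcal H$; no moments are assumed. A Lipschitz hypersurface is a set of the form $\{z+\tau(z)v : z\in Z\}$, where $v\in\mathcal H\setminus\{0\}$, $Z=\{\lambda v:\lambda\in\mathbb R\}^\perp$ and $\tau:\mathcal H\to\mathbb R$ is Lipschitz. For a proper convex function $\psi:\mathcal H\to(-\infty,+\infty]$ let $\partial\psi(x)=\{y\in\mathcal H:\ \psi(x)+\langle y,x'-x\rangle\le\psi(x')\ \text{for all } x'\in\mathcal H\}$, and write $\nabla\psi(x)$ for the unique element of $\partial\psi(x)$ whenever $\partial\psi(x)$ is a singleton. We say that $\nabla\psi$ pushes $\mathrm P$ forward to $\mathrm Q$ if $\partial\psi(x)$ is a singleton for $\mathrm P$-almost every $x$, the $\mathrm P$-a.e. defined map $\nabla\psi$ is $\mathrm P$-measurable, and $\nabla\psi\#\mathrm P=\mathrm Q$. Suppose that $\mathrm P$ gives mass zero to every Lipschitz hypersurface. Then: (i) there exists a proper lower semicontinuous convex function $\psi:\mathcal H\to(-\infty,+\infty]$ such that $\nabla\psi$ pushes $\mathrm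 P$ forward to $\mathrm Q$; (ii) if in addition $\operatorname{supp}(\mathrm Q)$ is bounded, then $\nabla\psi$ is unique $\mathrm P$-a.s.: if $\psi_1,\psi_2:\mathcal H\to(-\infty,+\infty]$ are proper convex functions (lower semicontinuous or not) whose gradients both push $\mathrm P$ forward to $\mathrm Q$, then $\nabla\psi_1=\nabla\psi_2$ $\mathrm P$-a.s. -/

import Mathlib

open MeasureTheory

namespace HilbertTransport

variable {H : Type*} [NormedAddCommGroup H] [InnerProductSpace ℝ H]

/-- A proper convex function `ψ : H → (-∞, +∞]`: it never takes the value `-∞`, is not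
identically `+∞`, and satisfies the convexity inequality in the extended reals. -/
structure IsProperConvex (ψ : H → EReal) : Prop where
  ne_bot : ∀ x, ψ x ≠ ⊥
  exists_ne_top : ∃ x, ψ x ≠ ⊤
  convex : ∀ x y : H, ∀ a b : ℝ, 0 < a → 0 < b → a + b = 1 →
    ψ (a • x + b • y) ≤ (a : EReal) * ψ x + (b : EReal) * ψ y

/-- The subdifferential of `ψ` at `x`: all `y` with `ψ x + ⟪y, x' - x⟫ ≤ ψ x'` for every `x'`. -/
def subdifferential (ψ : H → EReal) (x : H) : Set H :=
  {y | ∀ x' : H, ψ x + ((inner ℝ y (x' - x) : ℝ) : EReal) ≤ ψ x'}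

/-- The points at which the subdifferential of `ψ` is a singleton. -/
def gradDomain (ψ : H → EReal) : Set H :=
  {x | ∃ y, subdifferential ψ x = {y}}

open Classical in
/-- The gradient of `ψ`: the unique element of the subdifferential on `gradDomain ψ`
(and, by convention, `0` elsewhere). -/
noncomputable def grad (ψ : H → EReal) (x : H) : H :=
  if h : ∃ y, subdifferential ψ x = {y} then h.choose else 0

/-- Lipschitz hypersurfaces: sets `{z + τ(z) v : z ∈ Z}`, where `v ≠ 0`, `Z` is the orthogonal
complement of the line spanned by `v`, and `τ : H → ℝ` is Lipschitz. -/
def IsLipschitzHypersurface (A : Set H) : Prop :=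
  ∃ v : H, v ≠ 0 ∧ ∃ τ : H → ℝ, (∃ K : NNReal, LipschitzWith K τ) ∧
    A = {x | ∃ z ∈ (Submodule.span ℝ {v})ᗮ, x = z + τ z • v}

/-- `P` gives mass zero to every Lipschitz hypersurface. -/
def NullOnLipschitzHypersurfaces [MeasurableSpace H] (P : Measure H) : Prop :=
  ∀ A : Set H, IsLipschitzHypersurface A → P A = 0

/-- The gradient of `ψ` is defined `P`-almost everywhere, is a `P`-measurable map, and pushes
`P` forward to `Q`. -/
structure GradPushesForward [MeasurableSpace H] (ψ : H → EReal) (P Q : Measure H) : Prop where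
  ae_mem_gradDomain : ∀ᵐ x ∂P, x ∈ gradDomain ψ
  aemeasurable : AEMeasurable (grad ψ) P
  map_eq : P.map (grad ψ) = Q

end HilbertTransport

/-! ### Uniqueness of the transporting gradient through conjugates. -/

namespace HilbertTransport

/-! Uniqueness: write `ψ*` for the conjugate and set `G = ψ₂* - ψ₁*`. Fenchel–Young gives `G(∇ψ₂ x)
≤ ψ₁ x - ψ₂ x ≤ G(∇ψ₁ x)` almost everywhere. Both ends have the same law, the image of `Q` under
`G`, so they agree almost surely. Equality in Fenchel–Young then puts `∇ψ₁ x` in `∂ψ₂ x = {∇ψ₂ x}`.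
Only laws are compared, so no moments enter.

Existence: the cost `-⟪y, x⟫` may have no finite integral, so it is truncated to `[-n, n]`. Optimal
couplings for the truncated costs accumulate weakly at a coupling of `P` and `Q` with cyclically
monotone support (`exists_coupling_cyclicallyMonotone_support`). Rockafellar's potential `ψ` of that
support has the support inside the graph of `∂ψ`. As `∂ψ` is monotone, the points where it is
multivalued lie on countably many Lipschitz hypersurfaces
(`NullOnLipschitzHypersurfaces.ae_subsingleton`), so the coupling is carried by the graph of `∇ψ`.
-/

/-- Two almost surely ordered real random variables with the same law agree almost surely. -/
lemma ae_eq_of_ae_le_of_map_eq {Ω : Type*} [MeasurableSpace Ω] {μ : Measure Ω} [IsFiniteMeasure μ]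
    {f g : Ω → ℝ} (hf : AEMeasurable f μ) (hg : AEMeasurable g μ) (hle : f ≤ᵐ[μ] g)
    (hmap : μ.map f = μ.map g) : f =ᵐ[μ] g := by
  -- `arctan` is bounded and strictly increasing: it makes the integrals finite without losing the
  -- order.
  have hm : AEStronglyMeasurable Real.arctan (μ.map f) :=
    Real.continuous_arctan.aestronglyMeasurable
  have hm' : AEStronglyMeasurable Real.arctan (μ.map g) :=
    Real.continuous_arctan.aestronglyMeasurable
  have hint : ∀ h : Ω → ℝ, AEMeasurable h μ → Integrable (fun x => Real.arctan (h x)) μ := by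
    intro h hh
    refine Integrable.of_bound
      (Real.continuous_arctan.measurable.comp_aemeasurable hh).aestronglyMeasurable
      (Real.pi / 2) (Filter.Eventually.of_forall fun x => ?_)
    rw [Real.norm_eq_abs, abs_le]
    exact ⟨(Real.neg_pi_div_two_lt_arctan _).le, (Real.arctan_lt_pi_div_two _).le⟩
  have heq : ∫ x, Real.arctan (f x) ∂μ = ∫ x, Real.arctan (g x) ∂μ := by
    rw [← integral_map hf hm, ← integral_map hg hm', hmap]
  have hle' : (fun x => Real.arctan (f x)) ≤ᵐ[μ] fun x => Real.arctan (g x) := by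
    filter_upwards [hle] with x hx
    exact Real.arctan_strictMono.monotone hx
  filter_upwards [(integral_eq_iff_of_ae_le (hint f hf) (hint g hg) hle').1 heq] with x hx
  exact Real.arctan_strictMono.injective hx

variable {H : Type*} [NormedAddCommGroup H] [InnerProductSpace ℝ H]

lemma subdifferential_eq_singleton_grad {ψ : H → EReal} {x : H} (hx : x ∈ gradDomain ψ) :
    subdifferential ψ x = {grad ψ x} := by
  have hx' : ∃ y, subdifferential ψ x = {y} := hx
  rw [grad, dif_pos hx']
  exact hx'.choose_spec

lemma grad_mem_subdifferential {ψ : H → EReal} {x : H} (hx : x ∈ gradDomain ψ) :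
    grad ψ x ∈ subdifferential ψ x := by
  rw [subdifferential_eq_singleton_grad hx]
  rfl

lemma IsProperConvex.coe_toReal {ψ : H → EReal} (hψ : IsProperConvex ψ) {x y : H}
    (hy : y ∈ subdifferential ψ x) : ((ψ x).toReal : EReal) = ψ x := by
  refine EReal.coe_toReal (fun htop => ?_) (hψ.ne_bot x)
  obtain ⟨z, hz⟩ := hψ.exists_ne_top
  have h := hy z
  rw [htop, EReal.top_add_coe, top_le_iff] at h
  exact hz h

/-- The convex conjugate of `ψ`. -/
noncomputable def conjugate (ψ : H → EReal) (y : H) : EReal :=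
  ⨆ x, ((inner ℝ y x : ℝ) : EReal) - ψ x

/-- The supremum is uncountable, so measurability comes from lower semicontinuity. -/
lemma measurable_conjugate [MeasurableSpace H] [BorelSpace H] (ψ : H → EReal) :
    Measurable (conjugate ψ) := by
  refine LowerSemicontinuous.measurable (lowerSemicontinuous_iSup fun x => ?_)
  induction h : ψ x with
  | bot => simpa [h] using lowerSemicontinuous_const
  | top => simpa [h] using lowerSemicontinuous_const
  | coe r =>
    have : Continuous fun y : H => ((inner ℝ y x - r : ℝ) : EReal) :=
      continuous_coe_real_ereal.comp (by fun_prop)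
    simpa [h] using this.lowerSemicontinuous

lemma inner_sub_le_conjugate (ψ : H → EReal) (x y : H) :
    ((inner ℝ y x : ℝ) : EReal) - ψ x ≤ conjugate ψ y :=
  le_iSup (fun x => ((inner ℝ y x : ℝ) : EReal) - ψ x) x

/-- Equality case of the Fenchel–Young inequality. -/
lemma mem_subdifferential_iff_conjugate_le {ψ : H → EReal} (hψ : IsProperConvex ψ) {x y : H}
    {r : ℝ} (hr : ψ x = r) :
    y ∈ subdifferential ψ x ↔ conjugate ψ y ≤ ((inner ℝ y x - r : ℝ) : EReal) := by
  rw [conjugate, iSup_le_iff]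
  refine forall_congr' fun z => ?_
  rw [hr]
  have hb := hψ.ne_bot z
  induction hz : ψ z with
  | bot => exact absurd hz hb
  | top => simp
  | coe s =>
    rw [inner_sub_right]
    norm_cast
    constructor <;> intro h <;> linarith

lemma conjugate_eq_of_mem_subdifferential {ψ : H → EReal} (hψ : IsProperConvex ψ) {x y : H}
    {r : ℝ} (hr : ψ x = r) (hy : y ∈ subdifferential ψ x) :
    conjugate ψ y = ((inner ℝ y x - r : ℝ) : EReal) := by
  refine le_antisymm ((mem_subdifferential_iff_conjugate_le hψ hr).1 hy) ?_
  have := inner_sub_le_conjugate ψ x y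
  rwa [hr, ← EReal.coe_sub] at this

/-- A measure admits at most one push-forward to a given measure by the gradient of a convex
function. -/
theorem GradPushesForward.ae_eq [MeasurableSpace H] [BorelSpace H] {P Q : Measure H}
    [IsFiniteMeasure P] {ψ₁ ψ₂ : H → EReal}
    (h₁ : IsProperConvex ψ₁) (hp₁ : GradPushesForward ψ₁ P Q)
    (h₂ : IsProperConvex ψ₂) (hp₂ : GradPushesForward ψ₂ P Q) :
    ∀ᵐ x ∂P, grad ψ₁ x = grad ψ₂ x := by
  -- `ψ*` is finite on gradients of `ψ`, hence `Q`-a.e., hence also along any other map pushing `P`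
  -- to `Q`.
  have finite_conj : ∀ {ψ ψ' : H → EReal}, IsProperConvex ψ → GradPushesForward ψ P Q →
      GradPushesForward ψ' P Q → ∀ᵐ x ∂P,
        ((conjugate ψ (grad ψ' x)).toReal : EReal) = conjugate ψ (grad ψ' x) := by
    intro ψ ψ' h hp hp'
    have hmeas : MeasurableSet {y | ((conjugate ψ y).toReal : EReal) = conjugate ψ y} :=
      measurableSet_eq_fun (measurable_coe_real_ereal.comp (measurable_conjugate ψ).ereal_toReal)
        (measurable_conjugate ψ)
    have hQ : ∀ᵐ y ∂Q, ((conjugate ψ y).toReal : EReal) = conjugate ψ y := by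
      rw [← hp.map_eq, ae_map_iff hp.aemeasurable hmeas]
      filter_upwards [hp.ae_mem_gradDomain] with x hx
      have hy := grad_mem_subdifferential hx
      rw [conjugate_eq_of_mem_subdifferential h (h.coe_toReal hy).symm hy, EReal.toReal_coe]
    rw [← hp'.map_eq, ae_map_iff hp'.aemeasurable hmeas] at hQ
    exact hQ
  set G : H → ℝ := fun y => (conjugate ψ₂ y).toReal - (conjugate ψ₁ y).toReal with hG
  have hGm : Measurable G :=
    (measurable_conjugate ψ₂).ereal_toReal.sub (measurable_conjugate ψ₁).ereal_toReal
  have key : ∀ᵐ x ∂P, G (grad ψ₂ x) ≤ (ψ₁ x).toReal - (ψ₂ x).toReal ∧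
      (ψ₁ x).toReal - (ψ₂ x).toReal ≤ G (grad ψ₁ x) := by
    filter_upwards [hp₁.ae_mem_gradDomain, hp₂.ae_mem_gradDomain, finite_conj h₁ hp₁ hp₂,
      finite_conj h₂ hp₂ hp₁] with x hx₁ hx₂ hf₁ hf₂
    have hy₁ := grad_mem_subdifferential hx₁
    have hy₂ := grad_mem_subdifferential hx₂
    have hr₁ := (h₁.coe_toReal hy₁).symm
    have hr₂ := (h₂.coe_toReal hy₂).symm
    have e₁ := conjugate_eq_of_mem_subdifferential h₁ hr₁ hy₁
    have e₂ := conjugate_eq_of_mem_subdifferential h₂ hr₂ hy₂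
    have i₁ := inner_sub_le_conjugate ψ₁ x (grad ψ₂ x)
    have i₂ := inner_sub_le_conjugate ψ₂ x (grad ψ₁ x)
    rw [← hf₁, hr₁, ← EReal.coe_sub, EReal.coe_le_coe_iff] at i₁
    rw [← hf₂, hr₂, ← EReal.coe_sub, EReal.coe_le_coe_iff] at i₂
    simp only [hG, e₁, e₂, EReal.toReal_coe] at *
    constructor <;> linarith
  have hle : (fun x => G (grad ψ₂ x)) ≤ᵐ[P] fun x => G (grad ψ₁ x) :=
    key.mono fun x hx => hx.1.trans hx.2
  have hmap : P.map (fun x => G (grad ψ₂ x)) = P.map fun x => G (grad ψ₁ x) := by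
    have e₁ := AEMeasurable.map_map_of_aemeasurable hGm.aemeasurable hp₁.aemeasurable
    have e₂ := AEMeasurable.map_map_of_aemeasurable hGm.aemeasurable hp₂.aemeasurable
    rw [hp₁.map_eq] at e₁
    rw [hp₂.map_eq] at e₂
    exact e₂.symm.trans e₁
  have heq := ae_eq_of_ae_le_of_map_eq (hGm.comp_aemeasurable hp₂.aemeasurable)
    (hGm.comp_aemeasurable hp₁.aemeasurable) hle hmap
  filter_upwards [hp₁.ae_mem_gradDomain, hp₂.ae_mem_gradDomain, finite_conj h₂ hp₂ hp₁, key, heq]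
    with x hx₁ hx₂ hf hk he
  have hy₁ := grad_mem_subdifferential hx₁
  have hr₁ := (h₁.coe_toReal hy₁).symm
  have hr₂ := (h₂.coe_toReal (grad_mem_subdifferential hx₂)).symm
  have e₁ := conjugate_eq_of_mem_subdifferential h₁ hr₁ hy₁
  have hmem : grad ψ₁ x ∈ subdifferential ψ₂ x := by
    rw [mem_subdifferential_iff_conjugate_le h₂ hr₂, ← hf, EReal.coe_le_coe_iff]
    have h' := hk.1
    simp only [Function.comp_apply] at he
    rw [he] at h'
    simp only [hG, e₁, EReal.toReal_coe] at h'
    linarith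
  rw [subdifferential_eq_singleton_grad hx₂] at hmem
  exact hmem

end HilbertTransport

/-! ### Rockafellar's potential of a cyclically monotone set. -/

namespace HilbertTransport

variable {H : Type*} [NormedAddCommGroup H] [InnerProductSpace ℝ H]

/-- `ChainReach S p₀ p r`: some chain `p₀, p₁, …, pₙ = p` with `p₁, …, pₙ ∈ S` has total increment
`r = ∑ ⟪yᵢ, xᵢ₊₁ - xᵢ⟫`, where `pᵢ = (xᵢ, yᵢ)`. -/
inductive ChainReach (S : Set (H × H)) (p₀ : H × H) : H × H → ℝ → Prop
  | base : ChainReach S p₀ p₀ 0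
  | step {p q : H × H} {r : ℝ} : ChainReach S p₀ p r → q ∈ S →
      ChainReach S p₀ q (r + inner ℝ p.2 (q.1 - p.1))

/-- A set of pairs is cyclically monotone if matching the pairs as they are maximizes the total
inner product among all rearrangements of finitely many of them. -/
def CyclicallyMonotone (S : Set (H × H)) : Prop :=
  ∀ (n : ℕ) (q : Fin n → H × H) (σ : Equiv.Perm (Fin n)), (∀ i, q i ∈ S) →
    ∑ i, inner ℝ (q i).2 (q (σ i)).1 ≤ ∑ i, inner ℝ (q i).2 (q i).1

lemma ChainReach.exists_fin {S : Set (H × H)} {p₀ p : H × H} {r : ℝ} (h : ChainReach S p₀ p r)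
    (h₀ : p₀ ∈ S) : ∃ (n : ℕ) (q : Fin (n + 1) → H × H), (∀ i, q i ∈ S) ∧ q 0 = p₀ ∧
      q (Fin.last n) = p ∧
      r = ∑ i : Fin n, inner ℝ (q i.castSucc).2 ((q i.succ).1 - (q i.castSucc).1) := by
  induction h with
  | base => exact ⟨0, fun _ => p₀, fun _ => h₀, rfl, rfl, by simp⟩
  | @step p p' r _ hp' ih =>
    obtain ⟨n, q, hq, hq0, hql, hr⟩ := ih
    refine ⟨n + 1, Fin.snoc q p', fun i => ?_, ?_, by simp, ?_⟩
    · refine Fin.lastCases ?_ (fun j => ?_) i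
      · simpa using hp'
      · simpa using hq j
    · rw [← Fin.castSucc_zero, Fin.snoc_castSucc, hq0]
    · rw [Fin.sum_univ_castSucc, hr]
      congr 1
      · refine Finset.sum_congr rfl fun i _ => ?_
        rw [← Fin.castSucc_succ, Fin.snoc_castSucc, Fin.snoc_castSucc]
      · simp [hql]

/-- Returning to `p₀` closes the chain into a cycle, handled by the rotation permutation. This
bounds the potential by `0` at `p₀.1` and makes it proper. -/
lemma ChainReach.add_inner_nonpos {S : Set (H × H)} (hS : CyclicallyMonotone S) {p₀ p : H × H}
    {r : ℝ} (h : ChainReach S p₀ p r) (h₀ : p₀ ∈ S) : r + inner ℝ p.2 (p₀.1 - p.1) ≤ 0 := by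
  obtain ⟨n, q, hq, hq0, hql, rfl⟩ := h.exists_fin h₀
  have := hS (n + 1) q (finRotate (n + 1)) hq
  rw [Fin.sum_univ_castSucc, Fin.sum_univ_castSucc] at this
  simp only [finRotate_apply, Fin.coeSucc_eq_succ, Fin.last_add_one, hq0, hql] at this
  simp only [inner_sub_right, Finset.sum_sub_distrib]
  linarith

/-- Rockafellar's potential of a set of pairs. -/
noncomputable def rockafellar (S : Set (H × H)) (p₀ : H × H) (x : H) : EReal :=
  ⨆ (p : H × H) (r : ℝ) (_ : ChainReach S p₀ p r), ((r + inner ℝ p.2 (x - p.1) : ℝ) : EReal)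

lemma ChainReach.le_rockafellar {S : Set (H × H)} {p₀ p : H × H} {r : ℝ}
    (h : ChainReach S p₀ p r) (x : H) :
    ((r + inner ℝ p.2 (x - p.1) : ℝ) : EReal) ≤ rockafellar S p₀ x :=
  le_iSup_of_le p (le_iSup_of_le r (le_iSup_of_le h le_rfl))

lemma rockafellar_ne_bot (S : Set (H × H)) (p₀ : H × H) (x : H) : rockafellar S p₀ x ≠ ⊥ := by
  intro h
  have := (ChainReach.base (S := S) (p₀ := p₀)).le_rockafellar x
  rw [h, le_bot_iff] at this
  exact EReal.coe_ne_bot _ this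

lemma lowerSemicontinuous_rockafellar (S : Set (H × H)) (p₀ : H × H) :
    LowerSemicontinuous (rockafellar S p₀) := by
  refine lowerSemicontinuous_iSup fun p => lowerSemicontinuous_iSup fun r =>
    lowerSemicontinuous_iSup fun _ => Continuous.lowerSemicontinuous ?_
  exact continuous_coe_real_ereal.comp (by fun_prop)

lemma isProperConvex_rockafellar {S : Set (H × H)} (hS : CyclicallyMonotone S) {p₀ : H × H}
    (h₀ : p₀ ∈ S) : IsProperConvex (rockafellar S p₀) where
  ne_bot := rockafellar_ne_bot S p₀
  exists_ne_top := by
    refine ⟨p₀.1, ne_top_of_le_ne_top EReal.zero_ne_top ?_⟩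
    refine iSup_le fun p => iSup_le fun r => iSup_le fun h => ?_
    exact_mod_cast h.add_inner_nonpos hS h₀
  convex := by
    intro x y a b ha hb hab
    refine iSup_le fun p => iSup_le fun r => iSup_le fun h => ?_
    have hx := h.le_rockafellar x
    have hy := h.le_rockafellar y
    have key : r + inner ℝ p.2 (a • x + b • y - p.1) =
        a * (r + inner ℝ p.2 (x - p.1)) + b * (r + inner ℝ p.2 (y - p.1)) := by
      simp only [inner_sub_right, inner_add_right, inner_smul_right]
      linear_combination (-r + inner ℝ p.2 p.1) * hab
    rw [key, EReal.coe_add, EReal.coe_mul, EReal.coe_mul]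
    refine add_le_add (mul_le_mul_of_nonneg_left hx ?_) (mul_le_mul_of_nonneg_left hy ?_)
    · exact_mod_cast ha.le
    · exact_mod_cast hb.le

/-- Any chain can be prolonged by `p` before being evaluated at `x'`. -/
lemma mem_subdifferential_rockafellar {S : Set (H × H)} (p₀ : H × H) {p : H × H} (hp : p ∈ S) :
    p.2 ∈ subdifferential (rockafellar S p₀) p.1 := by
  intro x'
  rw [← EReal.le_sub_iff_add_le (Or.inl (EReal.coe_ne_bot _)) (Or.inl (EReal.coe_ne_top _))]
  refine iSup_le fun q => iSup_le fun r => iSup_le fun h => ?_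
  rw [EReal.le_sub_iff_add_le (Or.inl (EReal.coe_ne_bot _)) (Or.inl (EReal.coe_ne_top _)),
    ← EReal.coe_add]
  exact (h.step hp).le_rockafellar x'

lemma monotone_subdifferential {ψ : H → EReal} (hψ : IsProperConvex ψ) {x x' y y' : H}
    (hy : y ∈ subdifferential ψ x) (hy' : y' ∈ subdifferential ψ x') :
    0 ≤ inner ℝ (y - y') (x - x') := by
  have h := hy x'
  have h' := hy' x
  rw [← hψ.coe_toReal hy, ← hψ.coe_toReal hy', ← EReal.coe_add, EReal.coe_le_coe_iff] at h h'
  rw [← neg_sub x x', inner_neg_right] at h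
  rw [inner_sub_left]
  linarith

/-! ### Monotone maps are single-valued off Lipschitz hypersurfaces. -/

/-- A set on which the coordinate along `v` is a Lipschitz function of the orthogonal projection
onto `vᗮ` lies on a Lipschitz hypersurface. -/
lemma exists_hypersurface_of_lipschitz {v : H} (hv : v ≠ 0) {A : Set H} {K : NNReal}
    (hA : ∀ x ∈ A, ∀ x' ∈ A, ∀ (t : ℝ) (w : H), x - x' = t • v + w → inner ℝ v w = 0 →
      |t| ≤ K * ‖w‖) : ∃ B, IsLipschitzHypersurface B ∧ A ⊆ B := by
  have hvv : inner ℝ v v ≠ 0 := inner_self_ne_zero.2 hv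
  set t : H → ℝ := fun x => inner ℝ v x / inner ℝ v v with ht
  set π : H → H := fun x => x - t x • v with hπ
  have horth : ∀ x, inner ℝ v (π x) = 0 := by
    intro x
    simp only [hπ, ht, inner_sub_right, inner_smul_right]
    field_simp
    ring
  have hlip : ∀ x ∈ A, ∀ x' ∈ A, |t x - t x'| ≤ K * ‖π x - π x'‖ := by
    intro x hx x' hx'
    refine hA x hx x' hx' _ _ ?_ ?_
    · simp only [hπ, sub_smul]
      abel
    · rw [inner_sub_right, horth, horth, sub_zero]
  set f : H → ℝ := fun z => t (Function.invFunOn π A z) with hf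
  have hinv : ∀ z ∈ π '' A, Function.invFunOn π A z ∈ A ∧ π (Function.invFunOn π A z) = z :=
    fun z hz => Function.invFunOn_pos hz
  have hfl : LipschitzOnWith K f (π '' A) := by
    refine LipschitzOnWith.of_dist_le_mul fun z hz z' hz' => ?_
    have := hlip _ (hinv z hz).1 _ (hinv z' hz').1
    rwa [(hinv z hz).2, (hinv z' hz').2, ← Real.dist_eq, ← dist_eq_norm] at this
  obtain ⟨τ, hτ, hτf⟩ := hfl.extend_real
  refine ⟨_, ⟨v, hv, τ, ⟨K, hτ⟩, rfl⟩, fun x hx => ⟨π x, ?_, ?_⟩⟩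
  · rw [Submodule.mem_orthogonal_singleton_iff_inner_right]
    exact horth x
  · have hz : π x ∈ π '' A := ⟨x, hx, rfl⟩
    -- Points of `A` with the same projection have the same coordinate, so the choice made by
    -- `invFunOn` is harmless.
    have h := hlip _ (hinv _ hz).1 x hx
    rw [(hinv _ hz).2, sub_self, norm_zero, mul_zero] at h
    rw [← hτf hz, show f (π x) = t x from sub_eq_zero.1 (abs_nonpos_iff.1 h)]
    simp [hπ]

/-- The points at which a monotone multivalued map takes two values of norm at most `n` separated
by a definite gap along `v` lie on a Lipschitz hypersurface. -/
lemma exists_hypersurface_of_gap {T : H → Set H}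
    (hT : ∀ x x' y y', y ∈ T x → y' ∈ T x' → 0 ≤ inner ℝ (y - y') (x - x')) {v : H} (hv : v ≠ 0)
    {a b : ℝ} (hab : a < b) (n : ℕ) :
    ∃ B, IsLipschitzHypersurface B ∧ {x | ∃ y₁ ∈ T x, ∃ y₂ ∈ T x, ‖y₁‖ ≤ n ∧ ‖y₂‖ ≤ n ∧
      inner ℝ y₁ v < a ∧ b < inner ℝ y₂ v} ⊆ B := by
  refine exists_hypersurface_of_lipschitz (K := ⟨2 * n / (b - a), by
    have := sub_pos.2 hab
    positivity⟩) hv ?_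
  -- Monotonicity reads `0 ≤ t⟪y - y', v⟫ + ⟪y - y', w⟫`, where the first inner product is below `a
  -- - b` and the second at most `2n‖w‖`. The sign of `t` decides which point supplies the low
  -- value.
  have key : ∀ x x' y y' : H, y ∈ T x → y' ∈ T x' → ‖y‖ ≤ n → ‖y'‖ ≤ n → inner ℝ y v < a →
      b < inner ℝ y' v → ∀ (t : ℝ) (w : H), x - x' = t • v + w → 0 ≤ t →
      t ≤ 2 * n / (b - a) * ‖w‖ := by
    intro x x' y y' hy hy' hn hn' ha hb t w h ht
    have h0 := hT x x' y y' hy hy'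
    rw [h, inner_add_right, inner_smul_right, inner_sub_left y y' v] at h0
    have h1 : inner ℝ (y - y') w ≤ 2 * n * ‖w‖ :=
      (real_inner_le_norm _ _).trans (mul_le_mul_of_nonneg_right
        ((norm_sub_le _ _).trans (by linarith)) (norm_nonneg _))
    have h2 : t * (b - a) ≤ t * (inner ℝ y' v - inner ℝ y v) :=
      mul_le_mul_of_nonneg_left (by linarith) ht
    rw [div_mul_eq_mul_div, le_div_iff₀ (sub_pos.2 hab)]
    linarith
  rintro x ⟨y₁, hy₁, y₂, hy₂, hn₁, hn₂, ha, hb⟩ x' ⟨y₁', hy₁', y₂', hy₂', hn₁', hn₂', ha', hb'⟩ t w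
    h -
  change |t| ≤ 2 * n / (b - a) * ‖w‖
  rcases le_total 0 t with ht | ht
  · rw [abs_of_nonneg ht]
    exact key x x' y₁ y₂' hy₁ hy₂' hn₁ hn₂' ha hb' t w h ht
  · rw [abs_of_nonpos ht, ← norm_neg w]
    refine key x' x y₁' y₂ hy₁' hy₂ hn₁' hn₂ ha' hb (-t) (-w) ?_ (by linarith)
    rw [← neg_sub, h, neg_smul, neg_add]

/-- A monotone multivalued map on a separable Hilbert space is at most single-valued almost
everywhere for every measure that does not charge Lipschitz hypersurfaces. -/
lemma NullOnLipschitzHypersurfaces.ae_subsingleton [TopologicalSpace.SeparableSpace H]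
    [MeasurableSpace H] {P : Measure H} (hP : NullOnLipschitzHypersurfaces P) {T : H → Set H}
    (hT : ∀ x x' y y', y ∈ T x → y' ∈ T x' → 0 ≤ inner ℝ (y - y') (x - x')) :
    ∀ᵐ x ∂P, (T x).Subsingleton := by
  set u := TopologicalSpace.denseSeq H
  -- Distinct values are separated along some vector of a dense sequence by rationals `a < b`, with
  -- norms below an integer: countably many null sets suffice.
  have hnull : ∀ (k : ℕ) (a b : ℚ) (n : ℕ), a < b → P {x | ∃ y₁ ∈ T x, ∃ y₂ ∈ T x, ‖y₁‖ ≤ n ∧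
      ‖y₂‖ ≤ n ∧ inner ℝ y₁ (u k) < (a : ℝ) ∧ (b : ℝ) < inner ℝ y₂ (u k)} = 0 := by
    intro k a b n hab
    have hab' : (a : ℝ) < b := by exact_mod_cast hab
    by_cases hv : u k = 0
    · convert measure_empty (μ := P)
      ext x
      simp only [hv, inner_zero_right, Set.mem_ofPred_eq, Set.mem_empty_iff_false, iff_false]
      rintro ⟨y₁, -, y₂, -, -, -, h1, h2⟩
      linarith
    · obtain ⟨B, hB, hsub⟩ := exists_hypersurface_of_gap hT hv hab' n
      exact measure_mono_null hsub (hP B hB)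
  have hall : ∀ᵐ x ∂P, ∀ (k : ℕ) (a b : ℚ) (n : ℕ), a < b → ¬ ∃ y₁ ∈ T x, ∃ y₂ ∈ T x, ‖y₁‖ ≤ n ∧
      ‖y₂‖ ≤ n ∧ inner ℝ y₁ (u k) < (a : ℝ) ∧ (b : ℝ) < inner ℝ y₂ (u k) := by
    simp only [ae_all_iff]
    intro k a b n hab
    rw [ae_iff]
    simpa only [not_not] using hnull k a b n hab
  filter_upwards [hall] with x hx y₁ hy₁ y₂ hy₂
  by_contra hne
  have hopen : IsOpen {v : H | inner ℝ y₁ v < inner ℝ y₂ v} :=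
    isOpen_lt (by fun_prop) (by fun_prop)
  have hne' : {v : H | inner ℝ y₁ v < inner ℝ y₂ v}.Nonempty := by
    refine ⟨y₂ - y₁, ?_⟩
    have : 0 < inner ℝ (y₂ - y₁) (y₂ - y₁) := real_inner_self_pos.2 (sub_ne_zero.2 (Ne.symm hne))
    rw [inner_sub_left] at this
    exact sub_pos.1 this
  obtain ⟨k, hk⟩ := (TopologicalSpace.denseRange_denseSeq H).exists_mem_open hopen hne'
  obtain ⟨b, hb₁, hb₂⟩ := exists_rat_btwn (show inner ℝ y₁ _ < inner ℝ y₂ _ from hk)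
  obtain ⟨a, ha₁, ha₂⟩ := exists_rat_btwn hb₁
  obtain ⟨n, hn⟩ := exists_nat_ge (max ‖y₁‖ ‖y₂‖)
  exact hx k a b n (by exact_mod_cast ha₂) ⟨y₁, hy₁, y₂, hy₂, (le_max_left _ _).trans hn,
    (le_max_right _ _).trans hn, ha₁, hb₂⟩

end HilbertTransport

/-! ### Couplings with cyclically monotone support. -/

namespace HilbertTransport

open Filter Topology ProbabilityTheory

variable {X Y : Type*} [MeasurableSpace X] [MeasurableSpace Y]

/-- A coupling that is optimal for a bounded cost cannot charge all the rectangles `U i ×ˢ V i` of a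
finite family whose rearrangement `U i ×ˢ V (σ i)` has strictly smaller total cost. -/
lemma exists_measure_prod_eq_zero_of_optimal {γ : Measure (X × Y)} [IsProbabilityMeasure γ]
    {c : X × Y → ℝ} (hc : Measurable c) {C : ℝ} (hC : ∀ p, |c p| ≤ C)
    (hopt : ∀ γ' : Measure (X × Y), IsProbabilityMeasure γ' → γ'.fst = γ.fst → γ'.snd = γ.snd →
      ∫ p, c p ∂γ ≤ ∫ p, c p ∂γ')
    {ι : Type*} [Fintype ι] (σ : Equiv.Perm ι) {U : ι → Set X} {V : ι → Set Y}
    (hU : ∀ i, MeasurableSet (U i)) (hV : ∀ i, MeasurableSet (V i)) {a b : ι → ℝ}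
    (ha : ∀ i, ∀ x ∈ U i, ∀ y ∈ V i, a i ≤ c (x, y))
    (hb : ∀ i, ∀ x ∈ U i, ∀ y ∈ V (σ i), c (x, y) ≤ b i) (hab : ∑ i, b i < ∑ i, a i) :
    ∃ i, γ (U i ×ˢ V i) = 0 := by
  by_contra! hpos
  have hne : Nonempty ι := by
    by_contra h
    rw [not_nonempty_iff] at h
    simp at hab
  have hUV : ∀ i, MeasurableSet (U i ×ˢ V i) := fun i => (hU i).prod (hV i)
  set m : ι → Measure (X × Y) := fun i => γ[|U i ×ˢ V i] with hm
  have hmp : ∀ i, IsProbabilityMeasure (m i) := fun i => cond_isProbabilityMeasure (hpos i)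
  -- With `ε = S⁻¹`, the mixture `ε ∑ m i` is dominated by `γ` even if the rectangles overlap.
  set S : ENNReal := ∑ i, (γ (U i ×ˢ V i))⁻¹ with hS
  have hS0 : S ≠ 0 := by
    intro h
    obtain ⟨i⟩ := hne
    exact ENNReal.inv_ne_zero.2 (measure_ne_top γ _) (Finset.sum_eq_zero_iff.1 h i (by simp))
  have hSt : S ≠ ⊤ := by
    rw [hS, ENNReal.sum_ne_top]
    exact fun i _ => ENNReal.inv_ne_top.2 (hpos i)
  set ε : ENNReal := S⁻¹ with hε
  have hε0 : 0 < ε.toReal :=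
    ENNReal.toReal_pos (ENNReal.inv_ne_zero.2 hSt) (ENNReal.inv_ne_top.2 hS0)
  have hεt : ε ≠ ⊤ := ENNReal.inv_ne_top.2 hS0
  set ν : Measure (X × Y) := ε • ∑ i, m i with hν
  -- Replacing `ν` by `ν'` inside `γ` only permutes second marginals, so it yields a competitor,
  -- cheaper by at least `ε (∑ a - ∑ b)`.
  set ν' : Measure (X × Y) := ε • ∑ i, ((m i).fst.prod (m (σ i)).snd) with hν'
  have hνfin : IsFiniteMeasure ν := by
    refine ⟨?_⟩
    simp only [hν, Measure.smul_apply, Measure.finsetSum_apply, measure_univ, smul_eq_mul]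
    exact ENNReal.mul_lt_top hεt.lt_top (by simp)
  have hν'fin : IsFiniteMeasure ν' := by
    refine ⟨?_⟩
    simp only [hν', Measure.smul_apply, Measure.finsetSum_apply, measure_univ, smul_eq_mul]
    exact ENNReal.mul_lt_top hεt.lt_top (by simp)
  have hle : ν ≤ γ := by
    refine Measure.le_iff.2 fun s hs => ?_
    calc ν s = ε * ∑ i, (γ (U i ×ˢ V i))⁻¹ * γ (U i ×ˢ V i ∩ s) := by
          simp only [hν, hm, Measure.smul_apply, Measure.finsetSum_apply, smul_eq_mul,
            cond_apply (hUV _)]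
      _ ≤ ε * ∑ i, (γ (U i ×ˢ V i))⁻¹ * γ s := by
          gcongr
          exact Set.inter_subset_right
      _ = γ s := by
          rw [← Finset.sum_mul, ← hS, ← mul_assoc, hε, ENNReal.inv_mul_cancel hS0 hSt, one_mul]
  have hsub : γ - ν + ν = γ := Measure.sub_add_cancel_of_le hle
  have hfin : IsFiniteMeasure (γ - ν) := isFiniteMeasure_of_le γ Measure.sub_le
  have hfst : ν'.fst = ν.fst := by
    simp only [hν, hν', Measure.fst, Measure.map_smul]
    rw [Measure.map_finset_sum measurable_fst.aemeasurable,
      Measure.map_finset_sum measurable_fst.aemeasurable]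
    congr 1
    exact Finset.sum_congr rfl fun i _ => Measure.fst_prod
  have hsnd : ν'.snd = ν.snd := by
    simp only [hν, hν', Measure.snd, Measure.map_smul]
    rw [Measure.map_finset_sum measurable_snd.aemeasurable,
      Measure.map_finset_sum measurable_snd.aemeasurable]
    congr 1
    rw [← Equiv.sum_comp σ (fun i => (m i).map Prod.snd)]
    exact Finset.sum_congr rfl fun i _ => Measure.snd_prod
  have hf : (γ - ν + ν').fst = γ.fst := by
    rw [Measure.fst_add, hfst, ← Measure.fst_add, hsub]
  have hs : (γ - ν + ν').snd = γ.snd := by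
    rw [Measure.snd_add, hsnd, ← Measure.snd_add, hsub]
  have hprob : IsProbabilityMeasure (γ - ν + ν') := by
    refine ⟨?_⟩
    rw [← Measure.fst_univ, hf, Measure.fst_univ, measure_univ]
  have hint : ∀ (μ : Measure (X × Y)) [IsFiniteMeasure μ], Integrable c μ := fun μ _ =>
    Integrable.of_bound hc.aestronglyMeasurable C (Eventually.of_forall hC)
  have h1 : ε.toReal * ∑ i, a i ≤ ∫ p, c p ∂ν := by
    rw [hν, integral_smul_measure, integral_finsetSum_measure fun i _ => hint _, smul_eq_mul]
    refine mul_le_mul_of_nonneg_left (Finset.sum_le_sum fun i _ => ?_) hε0.le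
    have hae : ∀ᵐ p ∂m i, a i ≤ c p := by
      filter_upwards [ae_cond_mem (hUV i)] with p hp
      exact ha i p.1 hp.1 p.2 hp.2
    simpa using integral_mono_ae (integrable_const (a i)) (hint (m i)) hae
  have h2 : ∫ p, c p ∂ν' ≤ ε.toReal * ∑ i, b i := by
    rw [hν', integral_smul_measure, integral_finsetSum_measure fun i _ => hint _, smul_eq_mul]
    refine mul_le_mul_of_nonneg_left (Finset.sum_le_sum fun i _ => ?_) hε0.le
    have h1 : ∀ᵐ x ∂(m i).fst, x ∈ U i := by
      refine (ae_map_iff measurable_fst.aemeasurable (hU i)).2 ?_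
      filter_upwards [ae_cond_mem (hUV i)] with p hp using hp.1
    have h2 : ∀ᵐ y ∂(m (σ i)).snd, y ∈ V (σ i) := by
      refine (ae_map_iff measurable_snd.aemeasurable (hV _)).2 ?_
      filter_upwards [ae_cond_mem (hUV (σ i))] with p hp using hp.2
    have hae : ∀ᵐ p ∂(m i).fst.prod (m (σ i)).snd, c p ≤ b i := by
      filter_upwards [Measure.quasiMeasurePreserving_fst.ae h1,
        Measure.quasiMeasurePreserving_snd.ae h2] with p hp hp'
      exact hb i p.1 hp p.2 hp'
    simpa using integral_mono_ae (hint _) (integrable_const (b i)) hae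
  have h3 := hopt _ hprob hf hs
  rw [integral_add_measure (hint _) (hint _)] at h3
  nth_rewrite 1 [← hsub] at h3
  rw [integral_add_measure (hint _) (hint _)] at h3
  have h4 := mul_lt_mul_of_pos_left hab hε0
  linarith

variable [TopologicalSpace X] [PolishSpace X] [BorelSpace X]
  [TopologicalSpace Y] [PolishSpace Y] [BorelSpace Y]

/-- The set of couplings of two probability measures on Polish spaces is weakly compact. -/
lemma isCompact_couplings (P : Measure X) (Q : Measure Y) [IsProbabilityMeasure P]
    [IsProbabilityMeasure Q] :
    IsCompact {γ : ProbabilityMeasure (X × Y) |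
      (γ : Measure (X × Y)).fst = P ∧ (γ : Measure (X × Y)).snd = Q} := by
  set K := {γ : ProbabilityMeasure (X × Y) |
      (γ : Measure (X × Y)).fst = P ∧ (γ : Measure (X × Y)).snd = Q} with hK
  let _ := TopologicalSpace.upgradeIsCompletelyMetrizable X
  let _ := TopologicalSpace.upgradeIsCompletelyMetrizable Y
  -- Prokhorov: tight marginals make the couplings tight, and the marginal constraints are weakly
  -- closed.
  have htight : IsTightMeasureSet {((μ : ProbabilityMeasure (X × Y)) : Measure (X × Y)) | μ ∈ K} := by
    refine IsTightMeasureSet.prodMk ?_ ?_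
    · refine (isTightMeasureSet_singleton (μ := P)).subset ?_
      rintro _ ⟨_, ⟨μ, hμ, rfl⟩, rfl⟩
      exact hμ.1
    · refine (isTightMeasureSet_singleton (μ := Q)).subset ?_
      rintro _ ⟨_, ⟨μ, hμ, rfl⟩, rfl⟩
      exact hμ.2
  have hclosed : IsClosed K := by
    have h1 := ProbabilityMeasure.continuous_map (Ω := X × Y) (Ω' := X) continuous_fst
    have h2 := ProbabilityMeasure.continuous_map (Ω := X × Y) (Ω' := Y) continuous_snd
    have e1 : K = (fun γ : ProbabilityMeasure (X × Y) =>
          γ.map (measurable_fst.aemeasurable (μ := (γ : Measure (X × Y))))) ⁻¹' {(⟨P, ‹_›⟩ : ProbabilityMeasure X)} ∩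
        (fun γ : ProbabilityMeasure (X × Y) =>
          γ.map (measurable_snd.aemeasurable (μ := (γ : Measure (X × Y))))) ⁻¹' {(⟨Q, ‹_›⟩ : ProbabilityMeasure Y)} := by
      ext γ
      refine and_congr ⟨fun h => ?_, fun h => congrArg Subtype.val h⟩
        ⟨fun h => ?_, fun h => congrArg Subtype.val h⟩
      · exact Subtype.ext (a2 := (⟨P, ‹_›⟩ : ProbabilityMeasure X)) h
      · exact Subtype.ext (a2 := (⟨Q, ‹_›⟩ : ProbabilityMeasure Y)) h
    rw [e1]
    exact (isClosed_singleton.preimage h1).inter (isClosed_singleton.preimage h2)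
  have := isCompact_closure_of_isTightMeasureSet htight
  rwa [hclosed.closure_eq] at this

/-- A bounded continuous cost admits an optimal coupling. -/
lemma exists_optimal_coupling (P : Measure X) (Q : Measure Y) [IsProbabilityMeasure P]
    [IsProbabilityMeasure Q] (c : BoundedContinuousFunction (X × Y) ℝ) :
    ∃ γ : ProbabilityMeasure (X × Y),
      ((γ : Measure (X × Y)).fst = P ∧ (γ : Measure (X × Y)).snd = Q) ∧
      ∀ γ' : Measure (X × Y), IsProbabilityMeasure γ' → γ'.fst = P → γ'.snd = Q →
        ∫ p, c p ∂(γ : Measure (X × Y)) ≤ ∫ p, c p ∂γ' := by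
  obtain ⟨γ, hγ, hmin⟩ := (isCompact_couplings P Q).exists_isMinOn
    ⟨⟨P.prod Q, inferInstance⟩, by simp, by simp⟩
    (ProbabilityMeasure.continuous_integral_boundedContinuousFunction (X := X × Y) c).continuousOn
  exact ⟨γ, hγ, fun γ' h hf hs => hmin (show (⟨γ', h⟩ : ProbabilityMeasure (X × Y)) ∈ _ from
    ⟨hf, hs⟩)⟩

/-- For every continuous cost, two probability measures on Polish spaces have a coupling whose
support is cyclically monotone, without any integrability of the cost. -/
theorem exists_coupling_cyclicallyMonotone_support (P : Measure X) (Q : Measure Y)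
    [IsProbabilityMeasure P] [IsProbabilityMeasure Q] {c : X × Y → ℝ} (hc : Continuous c) :
    ∃ γ : Measure (X × Y), IsProbabilityMeasure γ ∧ γ.fst = P ∧ γ.snd = Q ∧
      ∀ (n : ℕ) (q : Fin n → X × Y) (σ : Equiv.Perm (Fin n)), (∀ i, q i ∈ γ.support) →
        ∑ i, c (q i) ≤ ∑ i, c ((q i).1, (q (σ i)).2) := by
  set cb : ℕ → BoundedContinuousFunction (X × Y) ℝ := fun n =>
    BoundedContinuousFunction.ofNormedAddCommGroup (fun p => max (-(n : ℝ)) (min n (c p)))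
      (by fun_prop) n (fun p => by
        rw [Real.norm_eq_abs, abs_le]
        have hn : (0 : ℝ) ≤ n := n.cast_nonneg
        exact ⟨le_max_left _ _, max_le (by linarith) (min_le_left _ _)⟩) with hcb
  have hcba : ∀ n p, cb n p = max (-(n : ℝ)) (min n (c p)) := fun n p => rfl
  choose g hg hgopt using fun n => exists_optimal_coupling P Q (cb n)
  obtain ⟨γ, hγ, hlim⟩ := (isCompact_couplings P Q).ultrafilter_le_nhds'
    ((hyperfilter ℕ).map g) (Ultrafilter.mem_map.2 (univ_mem' hg))
  have hlim' : Tendsto g (hyperfilter ℕ : Filter ℕ) (𝓝 γ) := hlim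
  refine ⟨γ, inferInstance, hγ.1, hγ.2, fun n q σ hq => ?_⟩
  by_contra! hlt
  -- An error `η` in each of the `2n` cost values must not close the gap.
  obtain ⟨η, hη, hηn⟩ : ∃ η : ℝ, 0 < η ∧
      ∑ i, c ((q i).1, (q (σ i)).2) + n * (2 * η) < ∑ i, c (q i) := by
    refine ⟨(∑ i, c (q i) - ∑ i, c ((q i).1, (q (σ i)).2)) / (2 * (n + 1)),
      by have := sub_pos.2 hlt; positivity, ?_⟩
    have hn : (0 : ℝ) < n + 1 := by positivity
    have := sub_pos.2 hlt
    rw [← sub_pos]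
    field_simp
    linarith
  have hrect : ∀ i, ∃ U V U' V', IsOpen U ∧ IsOpen V ∧ IsOpen U' ∧ IsOpen V' ∧
      (q i).1 ∈ U ∧ (q i).2 ∈ V ∧ (q i).1 ∈ U' ∧ (q (σ i)).2 ∈ V' ∧
      (∀ x ∈ U, ∀ y ∈ V, c (q i) - η < c (x, y)) ∧
      (∀ x ∈ U', ∀ y ∈ V', c (x, y) < c ((q i).1, (q (σ i)).2) + η) := by
    intro i
    have o1 : IsOpen {p | c (q i) - η < c p} := isOpen_lt continuous_const hc
    have o2 : IsOpen {p | c p < c ((q i).1, (q (σ i)).2) + η} := isOpen_lt hc continuous_const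
    obtain ⟨U, V, hU, hV, hqU, hqV, hUV⟩ := isOpen_prod_iff.1 o1 (q i).1 (q i).2
      (show c (q i) - η < c (q i) by linarith)
    obtain ⟨U', V', hU', hV', hqU', hqV', hUV'⟩ := isOpen_prod_iff.1 o2 (q i).1 (q (σ i)).2
      (show c ((q i).1, (q (σ i)).2) < c ((q i).1, (q (σ i)).2) + η by linarith)
    exact ⟨U, V, U', V', hU, hV, hU', hV', hqU, hqV, hqU', hqV',
      fun x hx y hy => hUV ⟨hx, hy⟩, fun x hx y hy => hUV' ⟨hx, hy⟩⟩
  choose U V U' V' hU hV hU' hV' hqU hqV hqU' hqV' hlow hupp using hrect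
  set A : Fin n → Set X := fun i => U i ∩ U' i
  -- `(q i).2` is also the second entry of the rearranged pair with index `σ.symm i`.
  set B : Fin n → Set Y := fun i => V i ∩ V' (σ.symm i)
  have hA : ∀ i, IsOpen (A i) := fun i => (hU i).inter (hU' i)
  have hB : ∀ i, IsOpen (B i) := fun i => (hV i).inter (hV' _)
  -- Portmanteau: an open rectangle around a support point of the limit is eventually charged.
  have hpos : ∀ᶠ k in (hyperfilter ℕ : Filter ℕ), ∀ i, 0 < (g k : Measure (X × Y)) (A i ×ˢ B i) := by
    rw [eventually_all]
    intro i
    have hmem : q i ∈ A i ×ˢ B i :=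
      ⟨⟨hqU i, hqU' i⟩, hqV i, by simpa using hqV' (σ.symm i)⟩
    have hopen : IsOpen (A i ×ˢ B i) := (hA i).prod (hB i)
    exact eventually_lt_of_lt_liminf
      (((Measure.mem_support_iff_forall _).1 (hq i) _ (hopen.mem_nhds hmem)).trans_le
        (ProbabilityMeasure.le_liminf_measure_open_of_tendsto hlim' hopen))
  -- From level `N` on, truncation preserves the bounds on the rectangles.
  obtain ⟨N, hN⟩ : ∃ N : ℕ, ∀ i, c (q i) - η ≤ N ∧ -(N : ℝ) ≤ c ((q i).1, (q (σ i)).2) + η := by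
    have : ∀ᶠ N : ℕ in atTop, ∀ i, c (q i) - η ≤ N ∧ -(N : ℝ) ≤ c ((q i).1, (q (σ i)).2) + η := by
      rw [eventually_all]
      intro i
      filter_upwards [tendsto_natCast_atTop_atTop.eventually_ge_atTop (c (q i) - η),
        tendsto_natCast_atTop_atTop.eventually_ge_atTop (-(c ((q i).1, (q (σ i)).2) + η))]
        with N h1 h2
      exact ⟨h1, by linarith⟩
    exact this.exists
  obtain ⟨k, hk, hNk⟩ := (hpos.and
    ((eventually_ge_atTop N).filter_mono Nat.hyperfilter_le_atTop)).exists
  have hNk' : (N : ℝ) ≤ k := by exact_mod_cast hNk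
  obtain ⟨i, hi⟩ := exists_measure_prod_eq_zero_of_optimal (γ := (g k : Measure (X × Y)))
    (c := cb k) (cb k).continuous.measurable (C := ‖cb k‖) (fun p => (cb k).norm_coe_le_norm p)
    (by rw [(hg k).1, (hg k).2]; exact hgopt k) σ (U := A) (V := B)
    (fun i => (hA i).measurableSet) (fun i => (hB i).measurableSet)
    (a := fun i => c (q i) - η) (b := fun i => c ((q i).1, (q (σ i)).2) + η)
    (fun i x hx y hy => by
      rw [hcba]
      exact le_max_of_le_right (le_min ((hN i).1.trans hNk') (hlow i x hx.1 y hy.1).le))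
    (fun i x hx y hy => by
      rw [hcba]
      have hy' : y ∈ V' i := by simpa using hy.2
      exact max_le (by linarith [(hN i).2]) (min_le_of_right_le (hupp i x hx.2 y hy').le))
    (by
      simp only [Finset.sum_add_distrib, Finset.sum_sub_distrib, Finset.sum_const,
        Finset.card_univ, Fintype.card_fin, nsmul_eq_mul]
      linarith)
  exact (hk i).ne' hi

end HilbertTransport

/-! ### From the coupling to the gradient map. -/

namespace HilbertTransport

open ProbabilityTheory

/-- A Markov kernel that is almost surely the Dirac kernel of a map `f` makes `f` almost everywhere
measurable, and `f` then pushes the base measure forward to the second marginal. -/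
lemma aemeasurable_and_map_eq_of_ae_kernel {X Y : Type*} [MeasurableSpace X] [MeasurableSpace Y]
    [MeasurableSpace.CountablyGenerated Y] {P : Measure X} [SFinite P] {κ : Kernel X Y}
    [IsMarkovKernel κ] {f : X → Y} (h : ∀ᵐ x ∂P, ∀ᵐ y ∂κ x, y = f x) :
    AEMeasurable f P ∧ P.map f = (P ⊗ₘ κ).snd := by
  have hκ : ∀ B, MeasurableSet B → ∀ᵐ x ∂P, κ x B = (f ⁻¹' B).indicator 1 x := by
    intro B hB
    filter_upwards [h] with x hx
    by_cases hxB : f x ∈ B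
    · rw [Set.indicator_of_mem (by exact hxB), Pi.one_apply]
      refine (mem_ae_iff_prob_eq_one hB).1 ?_
      filter_upwards [hx] with y hy
      rwa [hy]
    · rw [Set.indicator_of_notMem (by exact hxB)]
      refine measure_eq_zero_iff_ae_notMem.2 ?_
      filter_upwards [hx] with y hy
      rwa [hy]
  -- `f` is not assumed measurable: `f ⁻¹' B` agrees a.e. with the measurable set `{x | κ x B = 1}`.
  have hf : AEMeasurable f P := by
    refine NullMeasurable.aemeasurable fun B hB => ?_
    have hm : MeasurableSet {x | κ x B = 1} :=
      measurableSet_eq_fun (κ.measurable_coe hB) measurable_const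
    refine hm.nullMeasurableSet.congr ?_
    filter_upwards [hκ B hB] with x hx
    refine propext ?_
    change κ x B = 1 ↔ f x ∈ B
    rw [hx]
    by_cases hxB : f x ∈ B <;> simp [hxB]
  refine ⟨hf, Measure.ext fun B hB => ?_⟩
  rw [Measure.map_apply_of_aemeasurable hf hB, Measure.snd_compProd, Measure.bind_apply hB
    κ.aemeasurable, lintegral_congr_ae (hκ B hB),
    lintegral_indicator_one₀ (hf.nullMeasurableSet_preimage hB)]

variable {H : Type*} [NormedAddCommGroup H] [InnerProductSpace ℝ H]

lemma grad_eq_of_subsingleton {ψ : H → EReal} {x y : H} (hy : y ∈ subdifferential ψ x)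
    (hs : (subdifferential ψ x).Subsingleton) : x ∈ gradDomain ψ ∧ y = grad ψ x := by
  have hx : x ∈ gradDomain ψ := ⟨y, hs.eq_singleton_of_mem hy⟩
  exact ⟨hx, hs hy (grad_mem_subdifferential hx)⟩

variable [CompleteSpace H] [TopologicalSpace.SeparableSpace H] [MeasurableSpace H] [BorelSpace H]

/-- If a coupling is carried by the graph of a subdifferential that is almost surely at most
single-valued, then the gradient pushes the first marginal forward to the second. -/
lemma gradPushesForward_of_coupling {ψ : H → EReal} {γ : Measure (H × H)} [IsProbabilityMeasure γ]
    (hγ : ∀ᵐ p ∂γ, p.2 ∈ subdifferential ψ p.1)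
    (hs : ∀ᵐ x ∂γ.fst, (subdifferential ψ x).Subsingleton) :
    GradPushesForward ψ γ.fst γ.snd := by
  have hdis : γ.fst ⊗ₘ γ.condKernel = γ := γ.disintegrate γ.condKernel
  have hae : ∀ᵐ x ∂γ.fst, ∀ᵐ y ∂γ.condKernel x, y ∈ subdifferential ψ x := by
    rw [← hdis] at hγ
    exact Measure.ae_ae_of_ae_compProd hγ
  have hk : ∀ᵐ x ∂γ.fst, ∀ᵐ y ∂γ.condKernel x, y = grad ψ x := by
    filter_upwards [hae, hs] with x hx hsx
    filter_upwards [hx] with y hy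
    exact (grad_eq_of_subsingleton hy hsx).2
  obtain ⟨hm, hmap⟩ := aemeasurable_and_map_eq_of_ae_kernel hk
  refine ⟨?_, hm, by rw [hmap, hdis]⟩
  filter_upwards [hae, hs] with x hx hsx
  obtain ⟨y, hy⟩ := hx.exists
  exact (grad_eq_of_subsingleton hy hsx).1

/-- Existence of a convex potential whose gradient transports `P` to `Q`. -/
theorem exists_gradPushesForward (P Q : Measure H) [IsProbabilityMeasure P] [IsProbabilityMeasure Q]
    (hP : NullOnLipschitzHypersurfaces P) :
    ∃ ψ : H → EReal, IsProperConvex ψ ∧ LowerSemicontinuous ψ ∧ GradPushesForward ψ P Q := by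
  obtain ⟨γ, hγ, rfl, rfl, hcm⟩ := exists_coupling_cyclicallyMonotone_support P Q
    (c := fun p : H × H => -inner ℝ p.2 p.1) (by fun_prop)
  have hS : CyclicallyMonotone γ.support := by
    intro n q σ hq
    -- `hcm` permutes second entries, `CyclicallyMonotone` first ones; hence the inverse.
    have h := hcm n q σ.symm hq
    simp only [Finset.sum_neg_distrib, neg_le_neg_iff] at h
    rw [← Equiv.sum_comp σ] at h
    simpa using h
  obtain ⟨p₀, hp₀⟩ := Measure.nonempty_support (IsProbabilityMeasure.ne_zero γ)
  have hψ := isProperConvex_rockafellar hS hp₀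
  refine ⟨_, hψ, lowerSemicontinuous_rockafellar _ _, gradPushesForward_of_coupling ?_
    (hP.ae_subsingleton fun x x' y y' hy hy' => monotone_subdifferential hψ hy hy')⟩
  filter_upwards [Measure.support_mem_ae (μ := γ)] with p hp
  exact mem_subdifferential_rockafellar p₀ hp

end HilbertTransport

theorem theorem1 {H : Type*} [NormedAddCommGroup H] [InnerProductSpace ℝ H] [CompleteSpace H]
    [TopologicalSpace.SeparableSpace H] [MeasurableSpace H] [BorelSpace H]
    (P Q : Measure H) [IsProbabilityMeasure P] [IsProbabilityMeasure Q]
    (hP : HilbertTransport.NullOnLipschitzHypersurfaces P) :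
    (∃ ψ : H → EReal, HilbertTransport.IsProperConvex ψ ∧ LowerSemicontinuous ψ ∧
      HilbertTransport.GradPushesForward ψ P Q) ∧
    (Bornology.IsBounded Q.support →
      ∀ ψ₁ ψ₂ : H → EReal,
        HilbertTransport.IsProperConvex ψ₁ → HilbertTransport.GradPushesForward ψ₁ P Q →
        HilbertTransport.IsProperConvex ψ₂ → HilbertTransport.GradPushesForward ψ₂ P Q →
        ∀ᵐ x ∂P, HilbertTransport.grad ψ₁ x = HilbertTransport.grad ψ₂ x) :=
  ⟨HilbertTransport.exists_gradPushesForward P Q hP,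
    fun _ _ _ h₁ hp₁ h₂ hp₂ => hp₁.ae_eq h₁ h₂ hp₂⟩
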